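/- **Proposition (CVaR strong stability).** Let $K\ge 1$ and let $F^{(1)},\dots,F^{(K)}$ be probability distributions on $\mathbb R$ (the arm distributions), each of them sub-Gaussian: there is $\sigma_i\ge 0$ such that, for $X\sim F^{(i)}$, $\mathbb E\,e^{\lambda(X-\mathbb E X)}\le e^{\sigma_i^2\lambda^2/2}$ for all $\lambda\in\mathbb R$. Let $\alpha\in(0,1)$. Distributions are identified with their distribution functions $F(y)=F((-\infty,y])$, and for finite signed measures $F$ on $\mathbb R$ with $\int|x|\,d|F|<\infty$ (such as differences of distributions with finite first moment) put $$\|F\|=\max\Big\{\sup_{y\in\mathbb R}|F(y)|,\ \Big|\int_{-\infty}^0x\,dF\Big|,\ \Big|\int_0^\infty x\,dF\Big|\Big\}.$$ For a distribution $F$ let $$\mathrm{VaR}_\alpha(F)=\inf\{y\in\mathbb R: F(y)\ge\alpha\},\qquad \mathrm{CVaR}_\alpha(F)=\mathrm{VaR}_\alpha(F)-\frac1\alpha\int_{-\infty}^{\mathrm{VaR}_\alpha(F)}F(y)\,dy .$$ Let $\mathcal D^\Delta=\{\sum_{i=1}^Kp_iF^{(i)}: p_i\ge0,\ \sum_ip_i=1\}$,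 and let $\hat{\mathcal D}$ be the set of all empirical distributions $\frac1t\sum_{s=1}^t\delta_{x_s}$ with $t\ge1$ and $x_1,\dots,x_t\in\mathbb R$. Then the maximum $c^*=\max_{F\in\mathcal D^\Delta}\|F\|$ exists, and $\mathrm{CVaR}_\alpha$ is strongly stable for $F^{(1)},\dots,F^{(K)}$ under $\|\cdot\|$ with parameters $$q=2,\qquad b=\frac1\alpha\Big(1+\frac{\max\{1,3c^*\}}{\min\{\alpha,1-\alpha\}}\Big).$$ That is, $b>0$, $q\ge 1$, and: 1. for all $F\in\mathcal D^\Delta$ and all $G\in\mathcal D^\Delta\cup\hat{\mathcal D}$, $\ |\mathrm{CVaR}_\alpha(F)-\mathrm{CVaR}_\alpha(G)|\le b\big(\|F-G\|+\|F-G\|^q\big)$; 2. there is a constant $a>0$, depending only on $F^{(1)},\dots,F^{(K)}$, such that for every $i$ and every i.i.d. sequence $X_1,X_2,\dots$ with distribution $F^{(i)}$, with $\hat F^{(i)}_t=\frac1t\sum_{s=1}^t\delta_{X_s}$, $$\mathbb P\big(\|\hat F^{(i)}_t-F^{(i)}\|\ge x\big)\le2\exp(-a\,t\,x^2)\qquad\text{for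 all }x>0,\ t\ge1 .$$ -/

import Mathlib

open MeasureTheory ProbabilityTheory
open scoped NNReal

universe u

noncomputable section

namespace CVaRBandit

/- Distributions, their convex combinations and their differences are all handled as finite signed
measures `ν` on `ℝ`; the function on `ℝ` that `ν` stands for is its distribution function below. -/

/-- The distribution function `y ↦ ν (-∞, y]`. -/
def distFun (ν : SignedMeasure ℝ) (y : ℝ) : ℝ := ν (Set.Iic y)

/-- Value at risk: `inf {y | F(y) ≥ α}`, where `F` is the distribution function of `ν`. -/
def VaR (α : ℝ) (ν : SignedMeasure ℝ) : ℝ := sInf {y : ℝ | α ≤ distFun ν y}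

/-- Conditional value at risk: `VaR_α(F) - (1/α) ∫_{-∞}^{VaR_α(F)} F(y) dy`. -/
def CVaR (α : ℝ) (ν : SignedMeasure ℝ) : ℝ :=
  VaR α ν - 1 / α * ∫ y in Set.Iic (VaR α ν), distFun ν y

/-- The supremum norm of the distribution function. -/
def supNorm (ν : SignedMeasure ℝ) : ℝ := ⨆ y : ℝ, |distFun ν y|

/-- The norm `max {‖F‖_∞, |∫_{-∞}^0 x dF|, |∫_0^∞ x dF|}`. -/
def cvarNorm (ν : SignedMeasure ℝ) : ℝ :=
  max (supNorm ν) (max |∫ᵛ x in Set.Iic (0 : ℝ), x ∂<•ν| |∫ᵛ x in Set.Ici (0 : ℝ), x ∂<•ν|)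

/-- The convex combinations `∑ i, p i • F i`, with `p` in the simplex, of the arm distributions. -/
def mixtures {K : ℕ} (F : Fin K → Measure ℝ) [∀ i, IsProbabilityMeasure (F i)] :
    Set (SignedMeasure ℝ) :=
  {ν | ∃ p ∈ stdSimplex ℝ (Fin K), ν = ∑ i, p i • (F i).toSignedMeasure}

/-- The empirical distribution of the real numbers `x 0, …, x (t - 1)`. -/
def empirical {t : ℕ} (x : Fin t → ℝ) : SignedMeasure ℝ :=
  (1 / (t : ℝ)) • ∑ s, (Measure.dirac (x s)).toSignedMeasure

/-- The empirical distributions of all real sequences of all lengths `t ≥ 1`. -/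
def empiricals : Set (SignedMeasure ℝ) :=
  {ν | ∃ t : ℕ, 1 ≤ t ∧ ∃ x : Fin t → ℝ, ν = empirical x}

/-- Strong stability, with parameters `b` and `q`, of the performance measure `R` for the arm
distributions `F` under the norm `N`. In `concentration` the sequence `X 0, X 1, …` is any i.i.d.
sequence of rewards of arm `i`, on any probability space; the constant `a` is chosen before these,
and so depends only on the arm distributions. -/
structure IsStronglyStable (N R : SignedMeasure ℝ → ℝ) {K : ℕ} (F : Fin K → Measure ℝ)
    [∀ i, IsProbabilityMeasure (F i)] (b q : ℝ) : Prop where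
  b_pos : 0 < b
  one_le_q : 1 ≤ q
  modulus : ∀ μ ∈ mixtures F, ∀ ν ∈ mixtures F ∪ empiricals,
    |R μ - R ν| ≤ b * (N (μ - ν) + N (μ - ν) ^ q)
  concentration : ∃ a : ℝ, 0 < a ∧ ∀ i : Fin K,
    ∀ (Ω : Type u) [MeasurableSpace Ω] (P : Measure Ω) [IsProbabilityMeasure P] (X : ℕ → Ω → ℝ),
      (∀ s, HasLaw (X s) (F i) P) → iIndepFun X P →
      ∀ t : ℕ, 1 ≤ t → ∀ x : ℝ, 0 < x →
        P.real {ω | x ≤ N (empirical (fun s : Fin t => X s ω) - (F i).toSignedMeasure)}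
          ≤ 2 * Real.exp (-a * t * x ^ 2)

/-- A distribution on the line is sub-Gaussian if, for some `c`, its centred moment generating
function exists everywhere and is at most `exp (c λ ^ 2 / 2)`. -/
def IsSubGaussian (μ : Measure ℝ) : Prop :=
  ∃ c : ℝ≥0, HasSubgaussianMGF (fun x => x - ∫ y, y ∂μ) c μ

end CVaRBandit

end

namespace CVaRBandit

open Set Filter Topology

/-! ### Probability measures as signed measures -/

/-! Modulus of continuity: `VaR` maximises `w ↦ w - (1/α) ∫_{-∞}^w F` (`sub_integral_le_CVaR`).
Evaluating the functional of `G` at the quantile `v` of `F` therefore bounds `CVaR F - CVaR G` by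
`(1/α) (∫_{-∞}^v G - ∫_{-∞}^v F)`, and the two quantiles are never compared. By the layer cake
formula the part of this integral below `0` is a difference of half-means, and the part between `0`
and `v` is at most `|v|` times the sup distance, so the total is at most `N (1 + |v|)` with `N = ‖F
- G‖` (`integral_Iic_sub_le`). Markov's inequality bounds `|v|` by the half-means
(`abs_VaR_mul_le`). For a mixture these are at most `c`, for the other distribution at most `c + N`;
the extra `N` produces the quadratic term, hence `q = 2`.

Concentration: the half-means of an empirical distribution are sample means of the 1-Lipschitz
functions `min x 0` and `max x 0`, which stay sub-Gaussian by symmetrisation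
(`hasSubgaussianMGF_of_lipschitz`), so Hoeffding applies. The sup distance is handled by a ghost
sample and random swaps, which reduce it to Rademacher sums over half-lines; their maximum has a
moment bound proved by induction on the sorted sample (`exists_signedCount_le`). A union bound gives
prefactor 8, lowered to 2 at the cost of a factor 3 in the exponent.

The maximum `c` exists because on mixtures the norm is a continuous function of the weights, which
range over a compact simplex. -/

/-- The integral of the identity over the negative half-line. -/
noncomputable def lowerMean (μ : Measure ℝ) : ℝ := ∫ x in Iic (0 : ℝ), x ∂μ

/-- The integral of the identity over the positive half-line. -/
noncomputable def upperMean (μ : Measure ℝ) : ℝ := ∫ x in Ici (0 : ℝ), x ∂μ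

lemma distFun_toSignedMeasure (μ : Measure ℝ) [IsFiniteMeasure μ] (y : ℝ) :
    distFun μ.toSignedMeasure y = μ.real (Iic y) := by
  simp [distFun]

lemma distFun_sub (μ ν : SignedMeasure ℝ) (y : ℝ) :
    distFun (μ - ν) y = distFun μ y - distFun ν y := by
  simp [distFun]

lemma setIntegral_sub_toSignedMeasure {μ ν : Measure ℝ} [IsFiniteMeasure μ] [IsFiniteMeasure ν]
    (hμ : Integrable (fun x => x) μ) (hν : Integrable (fun x => x) ν) {s : Set ℝ}
    (hs : MeasurableSet s) :
    ∫ᵛ x in s, x ∂<•(μ.toSignedMeasure - ν.toSignedMeasure)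
      = ∫ x in s, x ∂μ - ∫ x in s, x ∂ν := by
  rw [VectorMeasure.restrict_sub, VectorMeasure.integral_sub_vectorMeasure,
    VectorMeasure.setIntegral_toSignedMeasure hs, VectorMeasure.setIntegral_toSignedMeasure hs]
  · rw [VectorMeasure.restrict_toSignedMeasure hs, VectorMeasure.Integrable,
      Measure.variation_toSignedMeasure]
    exact hμ.restrict
  · rw [VectorMeasure.restrict_toSignedMeasure hs, VectorMeasure.Integrable,
      Measure.variation_toSignedMeasure]
    exact hν.restrict

lemma cvarNorm_toSignedMeasure_sub {μ ν : Measure ℝ} [IsFiniteMeasure μ] [IsFiniteMeasure ν]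
    (hμ : Integrable (fun x => x) μ) (hν : Integrable (fun x => x) ν) :
    cvarNorm (μ.toSignedMeasure - ν.toSignedMeasure) =
      max (⨆ y, |μ.real (Iic y) - ν.real (Iic y)|)
        (max |lowerMean μ - lowerMean ν| |upperMean μ - upperMean ν|) := by
  simp only [cvarNorm, supNorm, distFun_sub, distFun_toSignedMeasure,
    setIntegral_sub_toSignedMeasure hμ hν measurableSet_Iic,
    setIntegral_sub_toSignedMeasure hμ hν measurableSet_Ici, lowerMean, upperMean]

lemma iSup_abs_measureReal_Iic (μ : Measure ℝ) [IsProbabilityMeasure μ] :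
    ⨆ y, |μ.real (Iic y)| = 1 := by
  have h : ∀ y, |μ.real (Iic y)| = μ.real (Iic y) := fun y => abs_of_nonneg measureReal_nonneg
  simp only [h]
  refine ciSup_eq_of_forall_le_of_forall_lt_exists_gt (fun y => measureReal_le_one) fun w hw => ?_
  have := (tendsto_cdf_atTop μ).eventually_const_lt hw
  obtain ⟨y, hy⟩ := this.exists
  exact ⟨y, by rwa [cdf_eq_real] at hy⟩

/-- The sup part is constant on probability measures, so only the half-means vary. This gives
continuity in the mixture weights and shows that the maximum is at least 1. -/
lemma cvarNorm_toSignedMeasure (μ : Measure ℝ) [IsProbabilityMeasure μ] :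
    cvarNorm μ.toSignedMeasure = max 1 (max |lowerMean μ| |upperMean μ|) := by
  simp only [cvarNorm, supNorm, distFun_toSignedMeasure, iSup_abs_measureReal_Iic,
    VectorMeasure.setIntegral_toSignedMeasure measurableSet_Iic,
    VectorMeasure.setIntegral_toSignedMeasure measurableSet_Ici, lowerMean, upperMean]

/-! ### Weighted sums of measures -/

section WeightedSum

variable {ι : Type*} [Fintype ι]

/-- The measure `∑ i, c i • μ i`. -/
noncomputable def weightedSum (c : ι → ℝ≥0) (μ : ι → Measure ℝ) : Measure ℝ := ∑ i, c i • μ i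

variable (c : ι → ℝ≥0) (μ : ι → Measure ℝ)

lemma weightedSum_apply (s : Set ℝ) : weightedSum c μ s = ∑ i, (c i : ENNReal) * μ i s := by
  rw [weightedSum, Measure.finsetSum_apply]
  rfl

instance [∀ i, IsFiniteMeasure (μ i)] : IsFiniteMeasure (weightedSum c μ) :=
  ⟨by
    rw [weightedSum_apply]
    exact ENNReal.sum_lt_top.2 fun i _ => ENNReal.mul_lt_top ENNReal.coe_lt_top
      (measure_lt_top _ _)⟩

lemma isProbabilityMeasure_weightedSum [∀ i, IsProbabilityMeasure (μ i)] (hc : ∑ i, c i = 1) :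
    IsProbabilityMeasure (weightedSum c μ) := by
  refine ⟨?_⟩
  simp only [weightedSum_apply, measure_univ, mul_one]
  exact_mod_cast hc

lemma toSignedMeasure_weightedSum [∀ i, IsFiniteMeasure (μ i)] :
    (weightedSum c μ).toSignedMeasure = ∑ i, (c i : ℝ) • (μ i).toSignedMeasure := by
  ext s hs
  rw [Measure.toSignedMeasure_apply_measurable hs, measureReal_def, weightedSum_apply,
    ENNReal.toReal_sum fun i _ => ENNReal.mul_ne_top ENNReal.coe_ne_top (measure_ne_top _ _)]
  have : (∑ i, (c i : ℝ) • (μ i).toSignedMeasure) s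
      = ∑ i, ((c i : ℝ) • (μ i).toSignedMeasure) s := by
    simp
  simp [hs, measureReal_def]

lemma integrable_weightedSum {f : ℝ → ℝ} (hf : ∀ i, Integrable f (μ i)) :
    Integrable f (weightedSum c μ) :=
  integrable_finsetSum_measure.2 fun i _ => (hf i).smul_measure_nnreal

lemma setIntegral_weightedSum {f : ℝ → ℝ} (hf : ∀ i, Integrable f (μ i)) (s : Set ℝ) :
    ∫ x in s, f x ∂(weightedSum c μ) = ∑ i, (c i : ℝ) * ∫ x in s, f x ∂(μ i) := by
  rw [weightedSum, ← Measure.restrictₗ_apply, map_sum, integral_finsetSum_measure]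
  · simp [NNReal.smul_def]
  · intro i _
    simpa using (hf i).restrict.smul_measure_nnreal

end WeightedSum

lemma exists_of_mem_mixtures {K : ℕ} {F : Fin K → Measure ℝ} [∀ i, IsProbabilityMeasure (F i)]
    (hF : ∀ i, Integrable (fun x => x) (F i)) {p : Fin K → ℝ} (hp : p ∈ stdSimplex ℝ (Fin K)) :
    ∃ (μ : Measure ℝ) (_ : IsProbabilityMeasure μ), Integrable (fun x => x) μ ∧
      ∑ i, p i • (F i).toSignedMeasure = μ.toSignedMeasure ∧
      lowerMean μ = ∑ i, p i * lowerMean (F i) ∧ upperMean μ = ∑ i, p i * upperMean (F i) := by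
  lift p to Fin K → ℝ≥0 using hp.1
  have h1 : ∑ i, p i = 1 := NNReal.coe_injective (by simpa using hp.2)
  exact ⟨weightedSum p F, isProbabilityMeasure_weightedSum p F h1, integrable_weightedSum p F hF,
    (toSignedMeasure_weightedSum p F).symm, setIntegral_weightedSum p F hF _,
    setIntegral_weightedSum p F hF _⟩

/-- With `min` and `max` the half-means become sample means of 1-Lipschitz functions, the form used
for concentration. -/
lemma exists_empirical_eq {t : ℕ} (ht : 1 ≤ t) (x : Fin t → ℝ) :
    ∃ (μ : Measure ℝ) (_ : IsProbabilityMeasure μ), Integrable (fun x => x) μ ∧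
      empirical x = μ.toSignedMeasure ∧
      (∀ y, μ.real (Iic y) = 1 / t * ∑ s, (Iic y).indicator 1 (x s)) ∧
      lowerMean μ = 1 / t * ∑ s, min (x s) 0 ∧ upperMean μ = 1 / t * ∑ s, max (x s) 0 := by
  have ht' : (t : ℝ) ≠ 0 := by positivity
  have hint : ∀ s, Integrable (fun y => y) (Measure.dirac (x s)) :=
    fun s => integrable_dirac (by simp)
  set c : Fin t → ℝ≥0 := fun _ => 1 / t with hc
  set D : Fin t → Measure ℝ := fun s => Measure.dirac (x s) with hD
  have : ∑ s, c s = 1 := by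
    simp only [hc, Finset.sum_const, Finset.card_univ, Fintype.card_fin, nsmul_eq_mul]
    have : (t : ℝ≥0) ≠ 0 := by exact_mod_cast ht'
    field_simp
  have hsm := toSignedMeasure_weightedSum c D
  have hcoe : ∀ s, (c s : ℝ) = 1 / t := by simp [hc]
  refine ⟨weightedSum c D, isProbabilityMeasure_weightedSum c D this,
    integrable_weightedSum c D hint, ?_, fun y => ?_, ?_, ?_⟩
  · rw [hsm, empirical, Finset.smul_sum]
    simp [hcoe, hD]
  · rw [← distFun_toSignedMeasure, hsm]
    have : ∀ ν : Fin t → SignedMeasure ℝ, distFun (∑ s, ν s) y = ∑ s, distFun (ν s) y :=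
      fun ν => by simp [distFun]
    rw [this, Finset.mul_sum]
    refine Finset.sum_congr rfl fun s _ => ?_
    have h2 : distFun ((c s : ℝ) • (D s).toSignedMeasure) y
        = c s * distFun (D s).toSignedMeasure y := by simp [distFun]
    rw [h2, hcoe s, distFun_toSignedMeasure, measureReal_def, Measure.dirac_apply' _ measurableSet_Iic]
    by_cases h : x s ∈ Iic y <;> simp [h]
  · rw [lowerMean, setIntegral_weightedSum c D hint, Finset.mul_sum]
    refine Finset.sum_congr rfl fun s _ => ?_
    rw [hcoe s, setIntegral_dirac (fun y => y)]
    by_cases h : x s ≤ 0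
    · simp [h]
    · simp [h, (not_le.1 h).le]
  · rw [upperMean, setIntegral_weightedSum c D hint, Finset.mul_sum]
    refine Finset.sum_congr rfl fun s _ => ?_
    rw [hcoe s, setIntegral_dirac (fun y => y)]
    by_cases h : 0 ≤ x s
    · simp [h]
    · simp [h, (not_le.1 h).le]

/-! ### Value at risk and conditional value at risk of a probability measure -/

section Quantile

variable {μ : Measure ℝ} [IsProbabilityMeasure μ]

lemma monotone_measureReal_Iic : Monotone fun y => μ.real (Iic y) :=
  fun _ _ h => measureReal_mono (Iic_subset_Iic.2 h)

variable {α : ℝ} (hα : α ∈ Ioo (0 : ℝ) 1)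
include hα

lemma VaR_set_nonempty : {y | α ≤ μ.real (Iic y)}.Nonempty := by
  obtain ⟨y, hy⟩ := ((tendsto_cdf_atTop μ).eventually_const_lt hα.2).exists
  exact ⟨y, by rw [cdf_eq_real] at hy; exact hy.le⟩

lemma VaR_set_bddBelow : BddBelow {y | α ≤ μ.real (Iic y)} := by
  obtain ⟨y, hy⟩ := ((tendsto_cdf_atBot μ).eventually_lt_const hα.1).exists
  rw [cdf_eq_real] at hy
  refine ⟨y, fun z hz => ?_⟩
  by_contra! h
  exact (hy.trans_le (hz.trans (monotone_measureReal_Iic h.le))).false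

lemma measureReal_Iic_lt_of_lt_VaR {y : ℝ} (hy : y < VaR α μ.toSignedMeasure) :
    μ.real (Iic y) < α := by
  simp only [VaR, distFun_toSignedMeasure] at hy
  by_contra! h
  exact notMem_of_lt_csInf hy (VaR_set_bddBelow hα) h

lemma le_measureReal_Iic_of_VaR_lt {y : ℝ} (hy : VaR α μ.toSignedMeasure < y) :
    α ≤ μ.real (Iic y) := by
  simp only [VaR, distFun_toSignedMeasure] at hy
  obtain ⟨z, hz, hzy⟩ := exists_lt_of_csInf_lt (VaR_set_nonempty hα) hy
  exact hz.trans (monotone_measureReal_Iic hzy.le)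

/-- Right-continuity of the distribution function: the infimum is attained. -/
lemma le_measureReal_Iic_VaR : α ≤ μ.real (Iic (VaR α μ.toSignedMeasure)) := by
  have h := (cdf μ).right_continuous (VaR α μ.toSignedMeasure)
  have h' := h.mono_left (nhdsWithin_mono _ Ioi_subset_Ici_self)
  rw [← cdf_eq_real]
  refine ge_of_tendsto h' ?_
  filter_upwards [self_mem_nhdsWithin] with y hy
  rw [cdf_eq_real]
  exact le_measureReal_Iic_of_VaR_lt hα hy

end Quantile

/-! ### Layer cake formula for the integrated distribution function -/

section LayerCake

variable {μ : Measure ℝ} (hμ : Integrable (fun x => x) μ)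
include hμ

lemma integrable_min_zero : Integrable (fun x => min x 0) μ := hμ.inf (integrable_zero _ _ _)

lemma integrable_max_zero : Integrable (fun x => max x 0) μ := hμ.sup (integrable_zero _ _ _)

omit hμ in
lemma lowerMean_eq : lowerMean μ = ∫ x, min x 0 ∂μ := by
  rw [lowerMean, ← integral_indicator measurableSet_Iic]
  refine integral_congr_ae (ae_of_all _ fun x => ?_)
  by_cases h : x ≤ 0
  · simp [h]
  · simp [h, (not_le.1 h).le]

omit hμ in
lemma upperMean_eq : upperMean μ = ∫ x, max x 0 ∂μ := by
  rw [upperMean, ← integral_indicator measurableSet_Ici]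
  refine integral_congr_ae (ae_of_all _ fun x => ?_)
  by_cases h : 0 ≤ x
  · simp [h]
  · simp [h, (not_le.1 h).le]

omit hμ in
lemma setOf_le_neg_min {t : ℝ} (ht : 0 < t) : {x : ℝ | t ≤ -min x 0} = Iic (-t) := by
  ext x
  simp only [mem_ofPred_eq, mem_Iic, le_neg, min_le_iff]
  constructor
  · rintro (h | h)
    · exact h
    · linarith
  · exact Or.inl

variable [IsProbabilityMeasure μ]

omit [IsProbabilityMeasure μ] in
lemma integral_Iic_measureReal_Iic : ∫ y in Iic (0 : ℝ), μ.real (Iic y) = -lowerMean μ := by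
  rw [lowerMean_eq, ← integral_neg,
    Integrable.integral_eq_integral_meas_le (f := fun x => -min x 0) (integrable_min_zero hμ).neg
      (ae_of_all _ fun x => by simp)]
  have h : ∀ t ∈ Ioi (0 : ℝ), μ.real {a | t ≤ -min a 0} = μ.real (Iic (-t)) :=
    fun t ht => by rw [setOf_le_neg_min ht]
  rw [setIntegral_congr_fun measurableSet_Ioi h, integral_comp_neg_Ioi 0 fun y => μ.real (Iic y),
    neg_zero]

/-- The preceding identity does not imply this, since a Bochner integral is `0` for non-integrable
functions; the layer cake formula for the Lebesgue integral supplies finiteness. -/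
lemma integrableOn_measureReal_Iic_zero :
    IntegrableOn (fun y => μ.real (Iic y)) (Iic (0 : ℝ)) := by
  have h1 : ∫⁻ t in Ioi (0 : ℝ), ENNReal.ofReal (μ.real (Iic (-t))) < ⊤ := by
    have := lintegral_eq_lintegral_meas_le μ (f := fun x => -min x 0) (ae_of_all _ fun x => by simp)
      (integrable_min_zero hμ).neg.aemeasurable
    have h2 : ∫⁻ t in Ioi (0 : ℝ), ENNReal.ofReal (μ.real (Iic (-t)))
        = ∫⁻ t in Ioi (0 : ℝ), μ {a | t ≤ -min a 0} := by
      refine setLIntegral_congr_fun measurableSet_Ioi fun t ht => ?_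
      rw [setOf_le_neg_min ht, ofReal_measureReal]
    rw [h2, ← this]
    exact (integrable_min_zero hμ).neg.lintegral_lt_top
  have hm : Measurable fun y => μ.real (Iic y) := monotone_measureReal_Iic.measurable
  have h3 : IntegrableOn (fun t => μ.real (Iic (-t))) (Ioi (0 : ℝ)) := by
    refine ⟨(hm.comp measurable_neg).aestronglyMeasurable, ?_⟩
    rw [hasFiniteIntegral_iff_ofReal (ae_of_all _ fun _ => measureReal_nonneg)]
    exact h1
  rw [integrableOn_Iic_iff_integrableOn_Iio]
  have := IntegrableOn.comp_neg_Iio (c := (0 : ℝ)) (f := fun t => μ.real (Iic (-t)))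
    (by simpa using h3)
  simpa using this

lemma integrableOn_measureReal_Iic (v : ℝ) : IntegrableOn (fun y => μ.real (Iic y)) (Iic v) := by
  refine ((integrableOn_measureReal_Iic_zero hμ).union
    ((monotone_measureReal_Iic.monotoneOn _).integrableOn_isCompact
      (isCompact_Icc (a := 0) (b := v)))).mono_set fun x hx => ?_
  rcases le_total x 0 with h | h
  · exact Or.inl h
  · exact Or.inr ⟨h, hx⟩

/-- The cut is at `0` because the norm controls the left tail only through the half-mean, and the
bounded piece through the sup norm. The oriented integral covers both signs of `v`. -/
lemma integral_Iic_eq_add (v : ℝ) :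
    ∫ y in Iic v, μ.real (Iic y) = -lowerMean μ + ∫ y in (0 : ℝ)..v, μ.real (Iic y) := by
  rw [← integral_Iic_measureReal_Iic hμ, ← intervalIntegral.integral_Iic_sub_Iic
    (integrableOn_measureReal_Iic hμ 0) (integrableOn_measureReal_Iic hμ v)]
  ring

end LayerCake

/-! ### Modulus of continuity of the conditional value at risk -/

section Comparison

lemma intervalIntegrable_measureReal_Iic {μ : Measure ℝ} [IsProbabilityMeasure μ] (a b : ℝ) :
    IntervalIntegrable (fun y => μ.real (Iic y)) volume a b :=
  monotone_measureReal_Iic.intervalIntegrable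

/-- Value at risk maximises `w ↦ w - (1/α) ∫_{-∞}^w F`. -/
lemma sub_integral_le_CVaR {μ : Measure ℝ} [IsProbabilityMeasure μ]
    (hμ : Integrable (fun x => x) μ) {α : ℝ} (hα : α ∈ Ioo (0 : ℝ) 1) (w : ℝ) :
    w - 1 / α * ∫ y in Iic w, μ.real (Iic y) ≤ CVaR α μ.toSignedMeasure := by
  have hα0 := hα.1
  simp only [CVaR, distFun_toSignedMeasure]
  set v := VaR α μ.toSignedMeasure with hv
  have hsub := intervalIntegral.integral_Iic_sub_Iic
    (integrableOn_measureReal_Iic hμ w) (integrableOn_measureReal_Iic hμ v)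
  -- The distribution function is below `α` left of `v` and at least `α` right of it, so moving from
  -- `v` in either direction loses.
  have key : ∫ y in w..v, μ.real (Iic y) ≤ α * (v - w) := by
    rcases le_total w v with h | h
    · calc ∫ y in w..v, μ.real (Iic y) ≤ ∫ y in w..v, α :=
            intervalIntegral.integral_mono_on_of_le_Ioo h (intervalIntegrable_measureReal_Iic _ _)
              intervalIntegrable_const fun y hy => (measureReal_Iic_lt_of_lt_VaR hα hy.2).le
        _ = α * (v - w) := by simp [mul_comm]
    · have : ∫ y in v..w, α ≤ ∫ y in v..w, μ.real (Iic y) :=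
        intervalIntegral.integral_mono_on_of_le_Ioo h intervalIntegrable_const
          (intervalIntegrable_measureReal_Iic _ _)
          fun y hy => le_measureReal_Iic_of_VaR_lt hα hy.1
      rw [intervalIntegral.integral_symm]
      simp only [intervalIntegral.integral_const, smul_eq_mul] at this
      linarith
  have : 1 / α * ((∫ y in Iic v, μ.real (Iic y)) - ∫ y in Iic w, μ.real (Iic y)) ≤ v - w := by
    rw [hsub, one_div, inv_mul_le_iff₀ hα0]
    exact key
  linarith

lemma abs_sub_le_iSup (μ ν : Measure ℝ) [IsProbabilityMeasure μ] [IsProbabilityMeasure ν] (y : ℝ) :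
    |μ.real (Iic y) - ν.real (Iic y)| ≤ ⨆ y, |μ.real (Iic y) - ν.real (Iic y)| := by
  refine le_ciSup (f := fun y => |μ.real (Iic y) - ν.real (Iic y)|) ⟨1, ?_⟩ y
  rintro _ ⟨z, rfl⟩
  exact abs_sub_le_of_nonneg_of_le measureReal_nonneg measureReal_le_one measureReal_nonneg
    measureReal_le_one

variable {μ ν : Measure ℝ} [IsProbabilityMeasure μ] [IsProbabilityMeasure ν]
  (hμ : Integrable (fun x => x) μ) (hν : Integrable (fun x => x) ν)
include hμ hν

lemma integral_Iic_sub_le (v : ℝ) :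
    (∫ y in Iic v, ν.real (Iic y)) - ∫ y in Iic v, μ.real (Iic y) ≤
      cvarNorm (μ.toSignedMeasure - ν.toSignedMeasure) * (1 + |v|) := by
  rw [cvarNorm_toSignedMeasure_sub hμ hν, integral_Iic_eq_add hμ, integral_Iic_eq_add hν]
  set S := ⨆ y, |μ.real (Iic y) - ν.real (Iic y)| with hS
  set N := max S (max |lowerMean μ - lowerMean ν| |upperMean μ - upperMean ν|) with hN
  have h1 : lowerMean μ - lowerMean ν ≤ N :=
    (le_abs_self _).trans ((le_max_left _ _).trans (le_max_right _ _))
  have h2 : (∫ y in (0 : ℝ)..v, ν.real (Iic y)) - ∫ y in (0 : ℝ)..v, μ.real (Iic y) ≤ N * |v| := by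
    rw [← intervalIntegral.integral_sub (intervalIntegrable_measureReal_Iic _ _)
      (intervalIntegrable_measureReal_Iic _ _)]
    have := intervalIntegral.norm_integral_le_of_norm_le_const (a := 0) (b := v) (C := N)
      (f := fun y => ν.real (Iic y) - μ.real (Iic y)) fun y _ => by
        rw [Real.norm_eq_abs, abs_sub_comm]
        exact (abs_sub_le_iSup μ ν y).trans (le_max_left _ _)
    rw [sub_zero] at this
    exact (le_abs_self _).trans this
  linarith

/-- The quantile of `μ` is a possibly suboptimal point for the maximisation that defines the value
at `ν`. -/
lemma CVaR_sub_le {α : ℝ} (hα : α ∈ Ioo (0 : ℝ) 1) :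
    CVaR α μ.toSignedMeasure - CVaR α ν.toSignedMeasure ≤
      1 / α * (cvarNorm (μ.toSignedMeasure - ν.toSignedMeasure)
        * (1 + |VaR α μ.toSignedMeasure|)) := by
  have hα0 := hα.1
  have h1 := sub_integral_le_CVaR hν hα (VaR α μ.toSignedMeasure)
  have h2 := mul_le_mul_of_nonneg_left (integral_Iic_sub_le hμ hν (VaR α μ.toSignedMeasure))
    (one_div_nonneg.2 hα0.le)
  have h3 : CVaR α μ.toSignedMeasure = VaR α μ.toSignedMeasure
      - 1 / α * ∫ y in Iic (VaR α μ.toSignedMeasure), μ.real (Iic y) := by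
    simp only [CVaR, distFun_toSignedMeasure]
  linarith

omit [IsProbabilityMeasure ν] hν in
-- Markov's inequality: mass at least `1 - α` lies on `[v, ∞)` and at least `α` on `(-∞, v]`; the
-- sign of `v` decides which is used.
lemma abs_VaR_mul_le {α : ℝ} (hα : α ∈ Ioo (0 : ℝ) 1) :
    |VaR α μ.toSignedMeasure| * min α (1 - α) ≤ max |lowerMean μ| |upperMean μ| := by
  set v := VaR α μ.toSignedMeasure with hv
  rcases le_total 0 v with h | h
  · refine le_trans ?_ (le_max_right _ _)
    refine le_trans ?_ (le_abs_self _)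
    rw [abs_of_nonneg h]
    refine (mul_le_mul_of_nonneg_left (min_le_right _ _) h).trans ?_
    -- Continuity from below along `v - 1/(n+1)`, where the distribution function is still less than
    -- `α`.
    have hIio : μ.real (Iio v) ≤ α := by
      by_contra! hlt
      have ht : Tendsto (fun n : ℕ => μ (Iic (v - 1 / ((n : ℝ) + 1)))) atTop (𝓝 (μ (Iio v))) := by
        have hU : ⋃ n : ℕ, Iic (v - 1 / ((n : ℝ) + 1)) = Iio v := by
          ext x
          simp only [mem_iUnion, mem_Iic, mem_Iio]
          constructor
          · rintro ⟨n, hn⟩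
            have : 0 < 1 / ((n : ℝ) + 1) := by positivity
            linarith
          · intro hx
            obtain ⟨n, hn⟩ := exists_nat_one_div_lt (sub_pos.2 hx)
            exact ⟨n, by linarith⟩
        rw [← hU]
        refine tendsto_measure_iUnion_atTop fun m n hmn => Iic_subset_Iic.2 ?_
        have : 1 / ((n : ℝ) + 1) ≤ 1 / ((m : ℝ) + 1) := by gcongr
        linarith
      have ht' := (ENNReal.tendsto_toReal (measure_ne_top μ _)).comp ht
      obtain ⟨n, hn⟩ := (ht'.eventually_const_lt hlt).exists
      have hpos : 0 < 1 / ((n : ℝ) + 1) := by positivity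
      have := measureReal_Iic_lt_of_lt_VaR (μ := μ) hα
        (y := v - 1 / ((n : ℝ) + 1)) (by rw [← hv]; linarith)
      exact (this.trans hn).false
    have hIci : 1 - α ≤ μ.real (Ici v) := by
      rw [← compl_Iio, probReal_compl_eq_one_sub measurableSet_Iio]
      linarith
    have hset : Ici v ⊆ {x : ℝ | v ≤ max x 0} := fun x hx => by
      simpa using Or.inl hx
    have hmk := mul_meas_ge_le_integral_of_nonneg (μ := μ) (f := fun x : ℝ => max x 0)
      (ae_of_all _ fun x => le_max_right _ _) (integrable_max_zero hμ) v
    rw [upperMean_eq]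
    refine le_trans ?_ hmk
    exact mul_le_mul_of_nonneg_left (hIci.trans (measureReal_mono hset)) h
  · refine le_trans ?_ (le_max_left _ _)
    refine le_trans ?_ (neg_le_abs _)
    rw [abs_of_nonpos h]
    refine (mul_le_mul_of_nonneg_left (min_le_left _ _) (neg_nonneg.2 h)).trans ?_
    have hset : Iic v ⊆ {x : ℝ | -v ≤ -min x 0} :=
      fun x hx => by simpa using Or.inl hx
    have hmk := mul_meas_ge_le_integral_of_nonneg (μ := μ) (f := fun x : ℝ => -min x 0)
      (ae_of_all _ fun x => by simp) (integrable_min_zero hμ).neg (-v)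
    rw [lowerMean_eq, ← integral_neg]
    refine le_trans ?_ hmk
    exact mul_le_mul_of_nonneg_left ((le_measureReal_Iic_VaR hα).trans (measureReal_mono hset))
      (neg_nonneg.2 h)

/-- Empirical distributions have no uniform bound on their half-means; the bound for `μ` transfers
to `ν` at the price of one norm. -/
lemma max_mean_le_add :
    max |lowerMean ν| |upperMean ν| ≤ max |lowerMean μ| |upperMean μ|
      + cvarNorm (μ.toSignedMeasure - ν.toSignedMeasure) := by
  rw [cvarNorm_toSignedMeasure_sub hμ hν]
  set L := |lowerMean μ - lowerMean ν| with hL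
  set U := |upperMean μ - upperMean ν| with hU
  have h1 : L ≤ max (⨆ y, |μ.real (Iic y) - ν.real (Iic y)|) (max L U) :=
    (le_max_left _ _).trans (le_max_right _ _)
  have h2 : U ≤ max (⨆ y, |μ.real (Iic y) - ν.real (Iic y)|) (max L U) :=
    (le_max_right _ _).trans (le_max_right _ _)
  refine max_le ?_ ?_
  · have := abs_sub_abs_le_abs_sub (lowerMean ν) (lowerMean μ)
    rw [abs_sub_comm, ← hL] at this
    linarith [le_max_left |lowerMean μ| |upperMean μ|]
  · have := abs_sub_abs_le_abs_sub (upperMean ν) (upperMean μ)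
    rw [abs_sub_comm, ← hU] at this
    linarith [le_max_right |lowerMean μ| |upperMean μ|]

/-- The modulus of continuity of `CVaR`. -/
lemma abs_CVaR_sub_le {α : ℝ} (hα : α ∈ Ioo (0 : ℝ) 1) {c : ℝ}
    (hc : cvarNorm μ.toSignedMeasure ≤ c) :
    |CVaR α μ.toSignedMeasure - CVaR α ν.toSignedMeasure| ≤
      1 / α * (1 + max 1 (3 * c) / min α (1 - α)) *
        (cvarNorm (μ.toSignedMeasure - ν.toSignedMeasure)
          + cvarNorm (μ.toSignedMeasure - ν.toSignedMeasure) ^ (2 : ℝ)) := by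
  have hα0 := hα.1
  have hm : 0 < min α (1 - α) := lt_min hα.1 (sub_pos.2 hα.2)
  rw [cvarNorm_toSignedMeasure] at hc
  have hN0 : 0 ≤ cvarNorm (μ.toSignedMeasure - ν.toSignedMeasure) := by
    rw [cvarNorm_toSignedMeasure_sub hμ hν]
    exact (abs_nonneg _).trans ((le_max_left _ _).trans (le_max_right _ _))
  have hsymm : cvarNorm (ν.toSignedMeasure - μ.toSignedMeasure)
      = cvarNorm (μ.toSignedMeasure - ν.toSignedMeasure) := by
    rw [cvarNorm_toSignedMeasure_sub hμ hν, cvarNorm_toSignedMeasure_sub hν hμ]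
    simp only [abs_sub_comm]
  have h1 := CVaR_sub_le hμ hν hα
  have h2 := CVaR_sub_le hν hμ hα
  rw [hsymm] at h2
  have hadd := max_mean_le_add hμ hν
  have hVμ := abs_VaR_mul_le hμ hα
  have hVν := abs_VaR_mul_le hν hα
  set N := cvarNorm (μ.toSignedMeasure - ν.toSignedMeasure)
  set m := min α (1 - α)
  set v := |VaR α μ.toSignedMeasure|
  set w := |VaR α ν.toSignedMeasure|
  have hc1 : (1 : ℝ) ≤ c := (le_max_left _ _).trans hc
  have hcM : max |lowerMean μ| |upperMean μ| ≤ c := (le_max_right _ _).trans hc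
  have hbound : ∀ z, z * m ≤ c + N → 1 / α * (N * (1 + z)) ≤
      1 / α * (1 + max 1 (3 * c) / m) * (N + N ^ (2 : ℝ)) := by
    intro z hz
    rw [mul_assoc]
    refine mul_le_mul_of_nonneg_left ?_ (one_div_nonneg.2 hα0.le)
    -- Since `c ≥ 1`, already `c + N ≤ c (1 + N)`; the factor 3 is slack.
    have hz' : z ≤ max 1 (3 * c) / m * (1 + N) := by
      rw [div_mul_eq_mul_div, le_div_iff₀ hm]
      have h3 : 3 * c ≤ max 1 (3 * c) := le_max_right _ _
      nlinarith
    have hR : N + N ^ (2 : ℝ) = N * (1 + N) := by rw [Real.rpow_two]; ring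
    rw [hR]
    calc N * (1 + z) ≤ N * ((1 + N) + max 1 (3 * c) / m * (1 + N)) := by
          refine mul_le_mul_of_nonneg_left ?_ hN0
          linarith
      _ = _ := by ring
  rw [abs_le]
  constructor
  · have := hbound w (by linarith)
    linarith
  · have := hbound v (by linarith)
    linarith

end Comparison

/-! ### A maximal inequality for Rademacher sums over half-lines -/

section Rademacher

variable {ι : Type*} [DecidableEq ι]

/-- The vector of signs that is `1` on `T` and `-1` off `T`. -/
def sign (T : Finset ι) (i : ι) : ℝ := if i ∈ T then 1 else -1

/-- The signed sum of the indicators of `x i ≤ y` over `i ∈ s`. -/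
noncomputable def signedCount (x : ι → ℝ) (s T : Finset ι) (y : ℝ) : ℝ :=
  ∑ i ∈ s, sign T i * (Iic y).indicator 1 (x i)

/-- As `a` is leftmost, a half-line that misses it misses every point. -/
lemma signedCount_insert {x : ι → ℝ} {s : Finset ι} {a : ι} (ha : a ∉ s)
    (hmin : ∀ i ∈ s, x a ≤ x i) (T : Finset ι) (y : ℝ) :
    signedCount x (insert a s) T y =
      if x a ≤ y then sign T a + signedCount x s T y else 0 := by
  split_ifs with h
  · simp [signedCount, Finset.sum_insert ha, h]
  · refine Finset.sum_eq_zero fun i hi => ?_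
    have hi' : x a ≤ x i := by
      rcases Finset.mem_insert.1 hi with rfl | hi
      exacts [le_rfl, hmin i hi]
    have : ¬ x i ≤ y := fun h' => h (hi'.trans h')
    simp [this]

lemma signedCount_congr {x : ι → ℝ} {s T T' : Finset ι} (h : ∀ i ∈ s, i ∈ T ↔ i ∈ T') (y : ℝ) :
    signedCount x s T y = signedCount x s T' y :=
  Finset.sum_congr rfl fun i hi => by simp [sign, h i hi]

/-- Clipping at `0` decreases the absolute value, hence `cosh`. It could increase `exp`, which is
why the induction runs with `cosh`. -/
lemma cosh_max_zero_le (l a m : ℝ) :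
    Real.cosh (l * max 0 (a + m)) ≤ Real.cosh (l * (a + m)) := by
  rw [Real.cosh_le_cosh, abs_mul, abs_mul]
  refine mul_le_mul_of_nonneg_left ?_ (abs_nonneg _)
  rw [abs_of_nonneg (le_max_left _ _)]
  exact max_le (abs_nonneg _) (le_abs_self _)

lemma cosh_add_cosh_le (l m : ℝ) :
    Real.cosh (l * max 0 (-1 + m)) + Real.cosh (l * max 0 (1 + m))
      ≤ 2 * Real.cosh l * Real.cosh (l * m) := by
  have h1 := cosh_max_zero_le l (-1) m
  have h2 := cosh_max_zero_le l 1 m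
  rw [mul_add, Real.cosh_add] at h1 h2
  simp only [mul_one, mul_neg, Real.cosh_neg, Real.sinh_neg] at h1 h2
  linarith

/-- `M T` dominates the running maximum of the signed sums. Adding a new leftmost point turns it
into `max 0 (± 1 + M)`, and averaging `cosh` over the two signs costs only a factor `cosh l`, with
no loss for the maximum. -/
lemma exists_signedCount_le (x : ι → ℝ) (l : ℝ) (s : Finset ι) :
    ∃ M : Finset ι → ℝ, (∀ T ⊆ s, 0 ≤ M T ∧ ∀ y, signedCount x s T y ≤ M T) ∧
      ∑ T ∈ s.powerset, Real.cosh (l * M T) ≤ (2 * Real.cosh l) ^ s.card := by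
  induction s using Finset.induction_on_min_value x with
  | empty => exact ⟨fun _ => 0, by simp [signedCount], by simp⟩
  | insert a s ha hmin ih =>
    obtain ⟨M, hM, hsum⟩ := ih
    refine ⟨fun T => max 0 (sign T a + M (T.erase a)), fun T hT => ⟨le_max_left _ _, fun y => ?_⟩, ?_⟩
    · have hTs : T.erase a ⊆ s := by
        rw [← Finset.erase_insert ha]
        exact Finset.erase_subset_erase a hT
      rw [signedCount_insert ha hmin]
      split_ifs
      · refine le_max_of_le_right (add_le_add_right ?_ _)
        rw [signedCount_congr (T' := T.erase a)]
        · exact (hM _ hTs).2 y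
        · intro i hi
          have : i ≠ a := fun h => ha (h ▸ hi)
          simp [this]
      · exact le_max_left _ _
    -- Subsets of `insert a s` pair up as `T` and `insert a T`, the two signs at `a`.
    · rw [Finset.sum_powerset_insert ha, ← Finset.sum_add_distrib, Finset.card_insert_of_notMem ha,
        pow_succ']
      calc _ ≤ ∑ T ∈ s.powerset, 2 * Real.cosh l * Real.cosh (l * M T) := by
            refine Finset.sum_le_sum fun T hT => ?_
            have haT : a ∉ T := fun h => ha (Finset.mem_powerset.1 hT h)
            dsimp only
            rw [Finset.erase_eq_of_notMem haT, Finset.erase_insert haT]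
            simp only [sign, haT, Finset.mem_insert_self, if_true, if_false]
            exact cosh_add_cosh_le l (M T)
        _ ≤ _ := by
            rw [← Finset.mul_sum]
            exact mul_le_mul_of_nonneg_left hsum (by positivity)

lemma signedCount_compl [Fintype ι] (x : ι → ℝ) (T : Finset ι) (y : ℝ) :
    signedCount x Finset.univ Tᶜ y = -signedCount x Finset.univ T y := by
  rw [signedCount, signedCount, ← Finset.sum_neg_distrib]
  refine Finset.sum_congr rfl fun i _ => ?_
  by_cases h : i ∈ T <;> simp [sign, h]

/-- Complementing `T` flips all signs, which gives the absolute value. One factor 2 comes from this,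
the other from `exp ≤ 2 cosh`. -/
lemma sum_exp_le_of_le_signedCount [Fintype ι] (x : ι → ℝ) (l : ℝ) (hl : 0 ≤ l) :
    ∑ T : Finset ι, Real.exp (l * ⨆ q : ℚ, |signedCount x Finset.univ T q|)
      ≤ 4 * (2 * Real.cosh l) ^ Fintype.card ι := by
  obtain ⟨M, hM, hsum⟩ := exists_signedCount_le x l Finset.univ
  rw [Finset.powerset_univ, Finset.card_univ] at hsum
  have hM' := fun T => hM T (Finset.subset_univ T)
  have hexp : ∀ T, Real.exp (l * M T) ≤ 2 * Real.cosh (l * M T) := fun T => by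
    rw [Real.cosh_eq]
    have := Real.exp_pos (-(l * M T))
    linarith
  have hS : ∑ T : Finset ι, Real.exp (l * M T) ≤ 2 * (2 * Real.cosh l) ^ Fintype.card ι :=
    (Finset.sum_le_sum fun T _ => hexp T).trans (by rw [← Finset.mul_sum]; linarith)
  have hSc : ∑ T : Finset ι, Real.exp (l * M Tᶜ) = ∑ T : Finset ι, Real.exp (l * M T) :=
    Equiv.sum_comp (Equiv.mk compl compl compl_compl compl_compl) fun T => Real.exp (l * M T)
  calc _ ≤ ∑ T : Finset ι, (Real.exp (l * M T) + Real.exp (l * M Tᶜ)) := by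
        refine Finset.sum_le_sum fun T _ => ?_
        have h1 : ⨆ q : ℚ, |signedCount x Finset.univ T q| ≤ max (M T) (M Tᶜ) := by
          refine ciSup_le fun q => abs_le'.2 ⟨?_, ?_⟩
          · exact le_max_of_le_left ((hM' T).2 q)
          · rw [← signedCount_compl]
            exact le_max_of_le_right ((hM' Tᶜ).2 q)
        have h2 := Real.exp_le_exp.2 (mul_le_mul_of_nonneg_left h1 hl)
        have h3 := Real.exp_pos (l * M T)
        have h4 := Real.exp_pos (l * M Tᶜ)
        rcases max_cases (M T) (M Tᶜ) with ⟨h, _⟩ | ⟨h, _⟩ <;> rw [h] at h2 <;> linarith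
    _ ≤ _ := by
        rw [Finset.sum_add_distrib, hSc]
        linarith

end Rademacher

/-! ### The Dvoretzky–Kiefer–Wolfowitz inequality, up to constants -/

section DKW

variable {t : ℕ}

/-- The largest difference, up to the factor `t`, of the empirical distribution functions of the
two samples that make up `z`. -/
noncomputable def twoSampleDev (z : Fin t → ℝ × ℝ) : ℝ :=
  ⨆ q : ℚ, |∑ i, ((Iic (q : ℝ)).indicator (1 : ℝ → ℝ) (z i).1 - (Iic (q : ℝ)).indicator 1 (z i).2)|

/-- The largest difference, up to the factor `t`, between the empirical distribution function of the
sample `x` and the distribution function of `μ`. -/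
noncomputable def oneSampleDev (μ : Measure ℝ) (x : Fin t → ℝ) : ℝ :=
  ⨆ q : ℚ, |∑ i, ((Iic (q : ℝ)).indicator (1 : ℝ → ℝ) (x i) - μ.real (Iic (q : ℝ)))|

lemma measurable_indicator_Iic (q : ℝ) : Measurable ((Iic q).indicator (1 : ℝ → ℝ)) :=
  measurable_one.indicator measurableSet_Iic

lemma indicator_Iic_mem (q x : ℝ) : (Iic q).indicator (1 : ℝ → ℝ) x ∈ Icc (0 : ℝ) 1 := by
  by_cases h : x ≤ q <;> simp [h]

lemma abs_sum_le_card {f : Fin t → ℝ} (hf : ∀ i, |f i| ≤ 1) : |∑ i, f i| ≤ t := by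
  refine (Finset.abs_sum_le_sum_abs _ _).trans ((Finset.sum_le_sum fun i _ => hf i).trans ?_)
  simp

lemma abs_sub_le_one {a b : ℝ} (ha : a ∈ Icc (0 : ℝ) 1) (hb : b ∈ Icc (0 : ℝ) 1) : |a - b| ≤ 1 :=
  abs_sub_le_of_nonneg_of_le ha.1 ha.2 hb.1 hb.2

lemma abs_twoSample_le (z : Fin t → ℝ × ℝ) (q : ℚ) :
    |∑ i, ((Iic (q : ℝ)).indicator (1 : ℝ → ℝ) (z i).1 - (Iic (q : ℝ)).indicator 1 (z i).2)| ≤ t :=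
  abs_sum_le_card fun _ => abs_sub_le_one (indicator_Iic_mem _ _) (indicator_Iic_mem _ _)

lemma le_twoSampleDev (z : Fin t → ℝ × ℝ) (q : ℚ) :
    |∑ i, ((Iic (q : ℝ)).indicator (1 : ℝ → ℝ) (z i).1 - (Iic (q : ℝ)).indicator 1 (z i).2)|
      ≤ twoSampleDev z :=
  le_ciSup (f := fun q : ℚ => |∑ i, ((Iic (q : ℝ)).indicator (1 : ℝ → ℝ) (z i).1
    - (Iic (q : ℝ)).indicator 1 (z i).2)|)
    ⟨t, by rintro _ ⟨q, rfl⟩; exact abs_twoSample_le z q⟩ q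

lemma twoSampleDev_nonneg (z : Fin t → ℝ × ℝ) : 0 ≤ twoSampleDev z :=
  (abs_nonneg _).trans (le_twoSampleDev z 0)

lemma twoSampleDev_le (z : Fin t → ℝ × ℝ) : twoSampleDev z ≤ t :=
  ciSup_le (abs_twoSample_le z)

/-- Rational thresholds keep the supremum countable. -/
lemma measurable_twoSampleDev : Measurable (twoSampleDev (t := t)) := by
  refine Measurable.iSup fun q => ?_
  have := measurable_indicator_Iic (q : ℝ)
  fun_prop

variable (μ : Measure ℝ) [IsProbabilityMeasure μ]

lemma abs_oneSample_le (x : Fin t → ℝ) (q : ℚ) :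
    |∑ i, ((Iic (q : ℝ)).indicator (1 : ℝ → ℝ) (x i) - μ.real (Iic (q : ℝ)))| ≤ t :=
  abs_sum_le_card fun _ => abs_sub_le_one (indicator_Iic_mem _ _)
    ⟨measureReal_nonneg, measureReal_le_one⟩

lemma le_oneSampleDev (x : Fin t → ℝ) (q : ℚ) :
    |∑ i, ((Iic (q : ℝ)).indicator (1 : ℝ → ℝ) (x i) - μ.real (Iic (q : ℝ)))|
      ≤ oneSampleDev μ x :=
  le_ciSup (f := fun q : ℚ => |∑ i, ((Iic (q : ℝ)).indicator (1 : ℝ → ℝ) (x i)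
    - μ.real (Iic (q : ℝ)))|)
    ⟨t, by rintro _ ⟨q, rfl⟩; exact abs_oneSample_le μ x q⟩ q

lemma oneSampleDev_le (x : Fin t → ℝ) : oneSampleDev μ x ≤ t :=
  ciSup_le (abs_oneSample_le μ x)

omit [IsProbabilityMeasure μ] in
lemma measurable_oneSampleDev : Measurable (oneSampleDev (t := t) μ) := by
  refine Measurable.iSup fun q => ?_
  have := measurable_indicator_Iic (q : ℝ)
  fun_prop

lemma integrable_of_mem_Icc {Ω : Type*} [MeasurableSpace Ω] {P : Measure Ω} [IsFiniteMeasure P]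
    {f : Ω → ℝ} (hf : Measurable f) {c : ℝ} (h0 : ∀ ω, 0 ≤ f ω) (h : ∀ ω, f ω ≤ c) :
    Integrable f P :=
  Integrable.of_bound hf.aestronglyMeasurable c (ae_of_all _ fun ω => by
    rw [Real.norm_of_nonneg (h0 ω)]; exact h ω)

lemma integrable_exp_mul_of_mem_Icc {Ω : Type*} [MeasurableSpace Ω] {P : Measure Ω}
    [IsFiniteMeasure P] {f : Ω → ℝ} (hf : Measurable f) {c l : ℝ} (hl : 0 ≤ l)
    (h : ∀ ω, f ω ≤ c) : Integrable (fun ω => Real.exp (l * f ω)) P :=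
  integrable_of_mem_Icc (c := Real.exp (l * c)) (by fun_prop) (fun _ => (Real.exp_pos _).le)
    fun ω => Real.exp_le_exp.2 (mul_le_mul_of_nonneg_left (h ω) hl)

/-- Jensen's inequality for the exponential function. -/
lemma exp_integral_le {Ω : Type*} [MeasurableSpace Ω] {P : Measure Ω} [IsProbabilityMeasure P]
    {f : Ω → ℝ} (hf : Integrable f P) (he : Integrable (fun ω => Real.exp (f ω)) P) :
    Real.exp (∫ ω, f ω ∂P) ≤ ∫ ω, Real.exp (f ω) ∂P :=
  convexOn_exp.map_integral_le Real.continuous_exp.continuousOn isClosed_univ (by simp) hf he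

lemma integral_indicator_Iic_pi (q : ℝ) (i : Fin t) :
    ∫ x, (Iic q).indicator (1 : ℝ → ℝ) (x i) ∂(Measure.pi fun _ : Fin t => μ)
      = μ.real (Iic q) := by
  rw [integral_comp_eval (μ := fun _ : Fin t => μ) (i := i)
    (f := (Iic q).indicator (1 : ℝ → ℝ)) (measurable_indicator_Iic q).aestronglyMeasurable,
    integral_indicator_one measurableSet_Iic]

/-- Ghost sample: `μ.real (Iic q)` is the mean of the indicator at an independent copy, and a
supremum of integrals is at most the integral of the supremum. -/
lemma oneSampleDev_le_integral (x : Fin t → ℝ) :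
    oneSampleDev μ x ≤ ∫ y, twoSampleDev (fun i => (x i, y i)) ∂(Measure.pi fun _ : Fin t => μ) := by
  have hmeas : Measurable fun y : Fin t → ℝ => twoSampleDev fun i => (x i, y i) :=
    measurable_twoSampleDev.comp (by fun_prop)
  refine ciSup_le fun q => ?_
  have hint : ∀ i, Integrable (fun y : Fin t → ℝ => (Iic (q : ℝ)).indicator (1 : ℝ → ℝ) (y i))
      (Measure.pi fun _ : Fin t => μ) := fun i =>
    integrable_of_mem_Icc ((measurable_indicator_Iic _).comp (measurable_pi_apply i))
      (fun y => (indicator_Iic_mem _ _).1) fun y => (indicator_Iic_mem _ _).2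
  have heq : ∑ i, ((Iic (q : ℝ)).indicator (1 : ℝ → ℝ) (x i) - μ.real (Iic (q : ℝ)))
      = ∫ y, ∑ i, ((Iic (q : ℝ)).indicator (1 : ℝ → ℝ) (x i)
        - (Iic (q : ℝ)).indicator (1 : ℝ → ℝ) (y i)) ∂(Measure.pi fun _ : Fin t => μ) := by
    rw [integral_finsetSum]
    swap
    · exact fun i _ => (integrable_const _).sub (hint i)
    refine Finset.sum_congr rfl fun i _ => ?_
    rw [integral_sub (integrable_const _) (hint i), integral_indicator_Iic_pi]
    simp
  rw [heq]
  refine (abs_integral_le_integral_abs).trans (integral_mono ?_ ?_ fun y => ?_)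
  · exact (integrable_finsetSum _ fun i _ => (integrable_const _).sub (hint i)).abs
  · exact integrable_of_mem_Icc hmeas (fun y => twoSampleDev_nonneg _) fun y => twoSampleDev_le _
  · exact le_twoSampleDev (fun i => (x i, y i)) q

lemma integral_exp_oneSampleDev_le {l : ℝ} (hl : 0 ≤ l) :
    ∫ x, Real.exp (l * oneSampleDev μ x) ∂(Measure.pi fun _ : Fin t => μ) ≤
      ∫ z, Real.exp (l * twoSampleDev z) ∂(Measure.pi fun _ : Fin t => μ.prod μ) := by
  have hmp := (measurePreserving_arrowProdEquivProdArrow ℝ ℝ (Fin t) (fun _ => μ) fun _ => μ).symm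
  rw [← hmp.integral_comp', integral_prod]
  · refine integral_mono (integrable_exp_mul_of_mem_Icc (measurable_oneSampleDev μ) hl
      (oneSampleDev_le μ)) ?_ fun x => ?_
    · refine Integrable.integral_prod_left (f := fun p : (Fin t → ℝ) × (Fin t → ℝ) =>
        Real.exp (l * twoSampleDev
          ((MeasurableEquiv.arrowProdEquivProdArrow ℝ ℝ (Fin t)).symm p))) ?_
      exact integrable_exp_mul_of_mem_Icc
        (measurable_twoSampleDev.comp (MeasurableEquiv.measurable _)) hl fun _ => twoSampleDev_le _
    · have hmeas : Measurable fun y : Fin t → ℝ => twoSampleDev fun i => (x i, y i) :=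
        measurable_twoSampleDev.comp (by fun_prop)
      have h1 := mul_le_mul_of_nonneg_left (oneSampleDev_le_integral μ x) hl
      rw [← integral_const_mul] at h1
      refine (Real.exp_le_exp.2 h1).trans (exp_integral_le ?_ ?_)
      · exact (integrable_of_mem_Icc hmeas (fun y => twoSampleDev_nonneg _)
          fun y => twoSampleDev_le _).const_mul l
      · exact integrable_exp_mul_of_mem_Icc hmeas hl fun _ => twoSampleDev_le _
  · exact integrable_exp_mul_of_mem_Icc
      (measurable_twoSampleDev.comp (MeasurableEquiv.measurable _)) hl fun _ => twoSampleDev_le _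

/-- Exchange of the two entries of `z i` for all `i` off `T`. -/
def swapOff (T : Finset (Fin t)) (z : Fin t → ℝ × ℝ) (i : Fin t) : ℝ × ℝ :=
  if i ∈ T then z i else (z i).swap

lemma measurePreserving_swapOff (T : Finset (Fin t)) :
    MeasurePreserving (swapOff T) (Measure.pi fun _ : Fin t => μ.prod μ)
      (Measure.pi fun _ : Fin t => μ.prod μ) := by
  have := measurePreserving_pi (fun _ : Fin t => μ.prod μ) (fun _ : Fin t => μ.prod μ)
    (f := fun i p => if i ∈ T then p else p.swap) fun i => by
      by_cases h : i ∈ T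
      · simp only [h, if_true]
        exact MeasurePreserving.id _
      · simpa [h] using Measure.measurePreserving_swap (μ := μ) (ν := μ)
  exact this

lemma abs_signedCount_le (x : Fin t → ℝ) (T : Finset (Fin t)) (q : ℚ) :
    |signedCount x Finset.univ T q| ≤ t :=
  abs_sum_le_card fun i => by
    have := indicator_Iic_mem q (x i)
    rw [abs_mul, abs_of_nonneg this.1]
    by_cases h : i ∈ T <;> simpa [sign, h] using this.2

/-- Each swap flips the sign of one summand, so the two samples separate into Rademacher sums with
the same signs. -/
lemma twoSampleDev_swapOff_le (T : Finset (Fin t)) (z : Fin t → ℝ × ℝ) :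
    twoSampleDev (swapOff T z) ≤ (⨆ q : ℚ, |signedCount (fun i => (z i).1) Finset.univ T q|)
      + ⨆ q : ℚ, |signedCount (fun i => (z i).2) Finset.univ T q| := by
  have hle : ∀ (x : Fin t → ℝ) (q : ℚ), |signedCount x Finset.univ T q|
      ≤ ⨆ q : ℚ, |signedCount x Finset.univ T q| := fun x q =>
    le_ciSup (f := fun q : ℚ => |signedCount x Finset.univ T q|)
      ⟨t, by rintro _ ⟨q, rfl⟩; exact abs_signedCount_le x T q⟩ q
  refine ciSup_le fun q => ?_
  have : ∑ i, ((Iic (q : ℝ)).indicator (1 : ℝ → ℝ) (swapOff T z i).1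
      - (Iic (q : ℝ)).indicator 1 (swapOff T z i).2)
      = signedCount (fun i => (z i).1) Finset.univ T q
        - signedCount (fun i => (z i).2) Finset.univ T q := by
    rw [signedCount, signedCount, ← Finset.sum_sub_distrib]
    refine Finset.sum_congr rfl fun i _ => ?_
    by_cases h : i ∈ T <;> simp [swapOff, sign, h]
    ring
  rw [this]
  exact (abs_sub _ _).trans (add_le_add (hle _ q) (hle _ q))

lemma sum_exp_twoSampleDev_le {l : ℝ} (hl : 0 ≤ l) (z : Fin t → ℝ × ℝ) :
    ∑ T : Finset (Fin t), Real.exp (l * twoSampleDev (swapOff T z))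
      ≤ 4 * (2 * Real.cosh (2 * l)) ^ t := by
  have h1 := sum_exp_le_of_le_signedCount (fun i => (z i).1) (2 * l) (by linarith)
  have h2 := sum_exp_le_of_le_signedCount (fun i => (z i).2) (2 * l) (by linarith)
  rw [Fintype.card_fin] at h1 h2
  -- The two suprema share their signs and are not independent; `2 e^{la} e^{lb} ≤ e^{2la} +
  -- e^{2lb}` decouples them and doubles `l`.
  have h3 : ∀ T : Finset (Fin t), Real.exp (l * twoSampleDev (swapOff T z)) ≤
      (Real.exp (2 * l * ⨆ q : ℚ, |signedCount (fun i => (z i).1) Finset.univ T q|)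
        + Real.exp (2 * l * ⨆ q : ℚ, |signedCount (fun i => (z i).2) Finset.univ T q|)) / 2 := by
    intro T
    set a := ⨆ q : ℚ, |signedCount (fun i => (z i).1) Finset.univ T q|
    set b := ⨆ q : ℚ, |signedCount (fun i => (z i).2) Finset.univ T q|
    have h4 := Real.exp_le_exp.2 (mul_le_mul_of_nonneg_left (twoSampleDev_swapOff_le T z) hl)
    rw [mul_add, Real.exp_add] at h4
    have ha : Real.exp (2 * l * a) = Real.exp (l * a) ^ 2 := by
      rw [← Real.exp_nat_mul]; congr 1; push_cast; ring
    have hb : Real.exp (2 * l * b) = Real.exp (l * b) ^ 2 := by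
      rw [← Real.exp_nat_mul]; congr 1; push_cast; ring
    rw [ha, hb]
    linarith [two_mul_le_add_sq (Real.exp (l * a)) (Real.exp (l * b))]
  refine (Finset.sum_le_sum fun T _ => h3 T).trans ?_
  rw [← Finset.sum_div, Finset.sum_add_distrib]
  linarith

/-- All `2 ^ t` swaps preserve the law, so the integral equals its average over them, which is
bounded pointwise in `z`. -/
lemma integral_exp_twoSampleDev_le {l : ℝ} (hl : 0 ≤ l) :
    ∫ z, Real.exp (l * twoSampleDev z) ∂(Measure.pi fun _ : Fin t => μ.prod μ)
      ≤ 4 * Real.cosh (2 * l) ^ t := by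
  set Q := Measure.pi fun _ : Fin t => μ.prod μ with hQ
  set I := ∫ z, Real.exp (l * twoSampleDev z) ∂Q with hI
  have hmeas : Measurable fun z : Fin t → ℝ × ℝ => Real.exp (l * twoSampleDev z) :=
    (measurable_twoSampleDev.const_mul l).exp
  have hT : ∀ T : Finset (Fin t), ∫ z, Real.exp (l * twoSampleDev (swapOff T z)) ∂Q = I := by
    intro T
    have h := (measurePreserving_swapOff μ T).map_eq
    rw [hI]
    conv_rhs => rw [hQ, ← h]
    rw [integral_map (measurePreserving_swapOff μ T).aemeasurable hmeas.aestronglyMeasurable]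
  have hint : ∀ T : Finset (Fin t),
      Integrable (fun z => Real.exp (l * twoSampleDev (swapOff T z))) Q := fun T =>
    integrable_exp_mul_of_mem_Icc
      (measurable_twoSampleDev.comp (measurePreserving_swapOff μ T).measurable) hl
      fun _ => twoSampleDev_le _
  have hsum : 2 ^ t * I ≤ 4 * (2 * Real.cosh (2 * l)) ^ t := by
    calc 2 ^ t * I = ∫ z, ∑ T : Finset (Fin t), Real.exp (l * twoSampleDev (swapOff T z)) ∂Q := by
          rw [integral_finsetSum _ fun T _ => hint T]
          simp [hT]
      _ ≤ ∫ _, 4 * (2 * Real.cosh (2 * l)) ^ t ∂Q :=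
          integral_mono (integrable_finsetSum _ fun T _ => hint T) (integrable_const _)
            fun z => sum_exp_twoSampleDev_le hl z
      _ = _ := by simp
  rw [mul_pow] at hsum
  have : (0 : ℝ) < 2 ^ t := by positivity
  nlinarith

lemma measureReal_oneSampleDev_ge_le {u : ℝ} (hu : 0 ≤ u) :
    (Measure.pi fun _ : Fin t => μ).real {x | t * u ≤ oneSampleDev μ x}
      ≤ 4 * Real.exp (-(t * u ^ 2 / 8)) := by
  -- Chernoff: `u / 4` minimises `-l t u + 2 l² t`.
  have hl : 0 ≤ u / 4 := by positivity
  have h1 := measure_ge_le_exp_mul_mgf (μ := Measure.pi fun _ : Fin t => μ)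
    (X := oneSampleDev μ) (t * u) hl
    (integrable_exp_mul_of_mem_Icc (measurable_oneSampleDev μ) hl (oneSampleDev_le μ))
  have h2 : mgf (oneSampleDev μ) (Measure.pi fun _ : Fin t => μ) (u / 4)
      ≤ 4 * Real.exp (t * u ^ 2 / 8) := by
    refine (integral_exp_oneSampleDev_le μ hl).trans ((integral_exp_twoSampleDev_le μ hl).trans ?_)
    refine mul_le_mul_of_nonneg_left ?_ (by norm_num)
    calc Real.cosh (2 * (u / 4)) ^ t ≤ Real.exp ((2 * (u / 4)) ^ 2 / 2) ^ t :=
          pow_le_pow_left₀ (Real.cosh_pos _).le (Real.cosh_le_exp_half_sq _) _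
      _ = _ := by rw [← Real.exp_nat_mul]; congr 1; ring
  calc _ ≤ _ := h1
    _ ≤ Real.exp (-(u / 4) * (t * u)) * (4 * Real.exp (t * u ^ 2 / 8)) :=
        mul_le_mul_of_nonneg_left h2 (Real.exp_pos _).le
    _ = 4 * (Real.exp (-(u / 4) * (t * u)) * Real.exp (t * u ^ 2 / 8)) := by ring
    _ = _ := by rw [← Real.exp_add]; congr 2; ring

end DKW

/-- A bound on the difference of two distribution functions at rational points holds everywhere. -/
lemma iSup_abs_sub_le_of_rat {μ ν : Measure ℝ} [IsProbabilityMeasure μ] [IsProbabilityMeasure ν]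
    {C : ℝ} (h : ∀ q : ℚ, |μ.real (Iic (q : ℝ)) - ν.real (Iic (q : ℝ))| ≤ C) :
    ⨆ y, |μ.real (Iic y) - ν.real (Iic y)| ≤ C := by
  refine ciSup_le fun y => ?_
  -- Approach from the right, where distribution functions are continuous.
  obtain ⟨u, -, hu, hlim⟩ := Real.exists_seq_rat_strictAnti_tendsto y
  have hlim' : Tendsto (fun n => (u n : ℝ)) atTop (𝓝[≥] y) :=
    tendsto_nhdsWithin_iff.2 ⟨hlim, Eventually.of_forall fun n => (hu n).le⟩
  have hm := ((cdf μ).right_continuous y).tendsto.comp hlim'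
  have hn := ((cdf ν).right_continuous y).tendsto.comp hlim'
  have := le_of_tendsto (hm.sub hn).abs (Eventually.of_forall fun n => by
    simpa only [Function.comp_apply, cdf_eq_real] using h (u n))
  simpa only [cdf_eq_real] using this

/-! ### Sub-Gaussian concentration of Lipschitz functions -/

section Lipschitz

lemma exp_add_exp_neg_le {a b : ℝ} (h : |a| ≤ |b|) :
    Real.exp a + Real.exp (-a) ≤ Real.exp b + Real.exp (-b) := by
  have := Real.cosh_le_cosh.2 h
  rw [Real.cosh_eq, Real.cosh_eq] at this
  linarith

variable {μ : Measure ℝ} [IsProbabilityMeasure μ] {f : ℝ → ℝ}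

omit [IsProbabilityMeasure μ] in
lemma integrable_exp_mul_of_lipschitz (hf : Measurable f) (hL : ∀ x y, |f x - f y| ≤ |x - y|)
    {m t : ℝ} (h1 : Integrable (fun x => Real.exp (t * (x - m))) μ)
    (h2 : Integrable (fun x => Real.exp (-t * (x - m))) μ) :
    Integrable (fun x => Real.exp (t * f x)) μ := by
  refine ((h1.add h2).const_mul (Real.exp (t * f m))).mono' (by fun_prop) (ae_of_all _ fun x => ?_)
  rw [Real.norm_of_nonneg (Real.exp_pos _).le]
  have h3 : |t * (f x - f m)| ≤ |t * (x - m)| := by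
    rw [abs_mul, abs_mul]
    exact mul_le_mul_of_nonneg_left (hL x m) (abs_nonneg _)
  have h4 := exp_add_exp_neg_le h3
  have h5 := Real.exp_pos (-(t * (f x - f m)))
  calc Real.exp (t * f x) = Real.exp (t * f m) * Real.exp (t * (f x - f m)) := by
        rw [← Real.exp_add]; ring_nf
    _ ≤ Real.exp (t * f m) * (Real.exp (t * (x - m)) + Real.exp (-t * (x - m))) := by
        refine mul_le_mul_of_nonneg_left ?_ (Real.exp_pos _).le
        rw [neg_mul]
        linarith

/-- A 1-Lipschitz function of a sub-Gaussian random variable is sub-Gaussian. -/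
lemma hasSubgaussianMGF_of_lipschitz {c : ℝ≥0} {m : ℝ}
    (hμ : HasSubgaussianMGF (fun x => x - m) c μ) (hf : Measurable f)
    (hL : ∀ x y, |f x - f y| ≤ |x - y|) (hfi : Integrable f μ) {d : ℝ≥0} (hd : 2 * c ≤ d) :
    HasSubgaussianMGF (fun x => f x - ∫ y, f y ∂μ) d μ := by
  have hE : ∀ t : ℝ, Integrable (fun x => Real.exp (t * f x)) μ := fun t =>
    integrable_exp_mul_of_lipschitz hf hL (hμ.integrable_exp_mul t) (hμ.integrable_exp_mul (-t))
  have hexp : ∀ t x : ℝ, Real.exp (t * (f x - ∫ y, f y ∂μ))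
      = Real.exp (-t * ∫ y, f y ∂μ) * Real.exp (t * f x) := fun t x => by
    rw [← Real.exp_add]; ring_nf
  refine ⟨fun t => ?_, fun t => ?_⟩
  · simp only [hexp]
    exact (hE t).const_mul _
  -- For independent copies `x`, `y` this compares the means of `cosh (t (f x - f y))` and `cosh (t
  -- (x - y))`; adding both orders of the product creates the `cosh`.
  have hprod : (∫ x, Real.exp (t * f x) ∂μ) * ∫ x, Real.exp (-t * f x) ∂μ ≤
      (∫ x, Real.exp (t * (x - m)) ∂μ) * ∫ x, Real.exp (-t * (x - m)) ∂μ := by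
    have e1 := integral_prod_mul (μ := μ) (ν := μ) (fun x => Real.exp (t * f x))
      fun x => Real.exp (-t * f x)
    have e2 := integral_prod_mul (μ := μ) (ν := μ) (fun x => Real.exp (-t * f x))
      fun x => Real.exp (t * f x)
    have e3 := integral_prod_mul (μ := μ) (ν := μ) (fun x => Real.exp (t * (x - m)))
      fun x => Real.exp (-t * (x - m))
    have e4 := integral_prod_mul (μ := μ) (ν := μ) (fun x => Real.exp (-t * (x - m)))
      fun x => Real.exp (t * (x - m))
    have i1 := (hE t).mul_prod (hE (-t))
    have i2 := (hE (-t)).mul_prod (hE t)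
    have i3 := (hμ.integrable_exp_mul t).mul_prod (hμ.integrable_exp_mul (-t))
    have i4 := (hμ.integrable_exp_mul (-t)).mul_prod (hμ.integrable_exp_mul t)
    have hle := integral_mono (i1.add i2) (i3.add i4) fun p => by
      have h3 : |t * (f p.1 - f p.2)| ≤ |t * (p.1 - p.2)| := by
        rw [abs_mul, abs_mul]
        exact mul_le_mul_of_nonneg_left (hL _ _) (abs_nonneg _)
      have h4 := exp_add_exp_neg_le h3
      simp only [Pi.add_apply, ← Real.exp_add]
      refine le_trans (le_of_eq ?_) (h4.trans (le_of_eq ?_)) <;> congr 2 <;> ring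
    simp only [Pi.add_apply] at hle
    rw [integral_add i1 i2, integral_add i3 i4, e1, e2, e3, e4] at hle
    linarith [mul_comm (∫ x, Real.exp (t * f x) ∂μ) (∫ x, Real.exp (-t * f x) ∂μ),
      mul_comm (∫ x, Real.exp (t * (x - m)) ∂μ) (∫ x, Real.exp (-t * (x - m)) ∂μ)]
  -- Jensen trades the centring for a second exponential moment, so two factors appear and the
  -- variance proxy doubles.
  have hJ : Real.exp (-t * ∫ y, f y ∂μ) ≤ ∫ x, Real.exp (-t * f x) ∂μ := by
    rw [← integral_const_mul]
    exact exp_integral_le (hfi.const_mul _) (hE (-t))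
  have hpos : 0 ≤ ∫ x, Real.exp (t * f x) ∂μ := integral_nonneg fun x => (Real.exp_pos _).le
  have hpos' : 0 ≤ ∫ x, Real.exp (-t * (x - m)) ∂μ := integral_nonneg fun x => (Real.exp_pos _).le
  have hb1 : ∫ x, Real.exp (t * (x - m)) ∂μ ≤ Real.exp (c * t ^ 2 / 2) := hμ.mgf_le t
  have hb2 : ∫ x, Real.exp (-t * (x - m)) ∂μ ≤ Real.exp (c * t ^ 2 / 2) := by
    have := hμ.mgf_le (-t)
    rwa [neg_sq] at this
  calc mgf (fun x => f x - ∫ y, f y ∂μ) μ t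
      = Real.exp (-t * ∫ y, f y ∂μ) * ∫ x, Real.exp (t * f x) ∂μ := by
        simp only [mgf, hexp, integral_const_mul]
    _ ≤ (∫ x, Real.exp (-t * f x) ∂μ) * ∫ x, Real.exp (t * f x) ∂μ :=
        mul_le_mul_of_nonneg_right hJ hpos
    _ ≤ (∫ x, Real.exp (t * (x - m)) ∂μ) * ∫ x, Real.exp (-t * (x - m)) ∂μ := by
        rw [mul_comm]; exact hprod
    _ ≤ Real.exp (c * t ^ 2 / 2) * Real.exp (c * t ^ 2 / 2) :=
        mul_le_mul hb1 hb2 hpos' (Real.exp_pos _).le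
    _ = Real.exp (2 * c * t ^ 2 / 2) := by rw [← Real.exp_add]; ring_nf
    _ ≤ Real.exp (d * t ^ 2 / 2) := by
        have : (2 * c : ℝ) ≤ d := by exact_mod_cast hd
        gcongr

end Lipschitz

lemma IsSubGaussian.integrable {μ : Measure ℝ} [IsProbabilityMeasure μ] (h : IsSubGaussian μ) :
    Integrable (fun x => x) μ := by
  obtain ⟨c, hc⟩ := h
  exact (hc.integrable.add (integrable_const (∫ y, y ∂μ))).congr (ae_of_all _ fun x => by simp)

/-! ### Concentration of the empirical distribution in the norm -/

section Concentration

variable {Ω : Type*} [MeasurableSpace Ω] {P : Measure Ω} [IsProbabilityMeasure P]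
  {μ : Measure ℝ} [IsProbabilityMeasure μ] {X : ℕ → Ω → ℝ}

omit [IsProbabilityMeasure μ] in
/-- Hoeffding's inequality for the empirical mean of `f` over a sample from `μ`. -/
lemma measureReal_abs_mean_sub_ge_le (hX : ∀ s, HasLaw (X s) μ P) (hind : iIndepFun X P)
    {f : ℝ → ℝ} (hf : Measurable f) {d : ℝ≥0}
    (hsub : HasSubgaussianMGF (fun x => f x - ∫ y, f y ∂μ) d μ) {t : ℕ} (ht : 1 ≤ t) {x : ℝ}
    (hx : 0 < x) :
    P.real {ω | x ≤ |1 / t * ∑ s : Fin t, f (X s ω) - ∫ y, f y ∂μ|}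
      ≤ 2 * Real.exp (-(t * x ^ 2 / (2 * d))) := by
  have ht' : (0 : ℝ) < t := by exact_mod_cast ht
  set Y : Fin t → Ω → ℝ := fun s ω => f (X s ω) - ∫ y, f y ∂μ with hY
  have hYind : iIndepFun Y P :=
    (hind.precomp Fin.val_injective).comp (fun _ x => f x - ∫ y, f y ∂μ)
      fun _ => hf.sub_const _
  have hYsub : ∀ s, HasSubgaussianMGF (Y s) d P := fun s => by
    refine HasSubgaussianMGF.of_map (X := fun x => f x - ∫ y, f y ∂μ) (hX s).aemeasurable ?_
    rw [(hX s).map_eq]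
    exact hsub
  have hYind' : iIndepFun (fun s ω => -Y s ω) P :=
    hYind.comp (fun _ x => -x) fun _ => measurable_neg
  have htx : 0 ≤ t * x := by positivity
  have h1 := HasSubgaussianMGF.measure_sum_ge_le_of_iIndepFun hYind (c := fun _ => d)
    (s := Finset.univ) (fun s _ => hYsub s) htx
  have h2 := HasSubgaussianMGF.measure_sum_ge_le_of_iIndepFun hYind' (c := fun _ => d)
    (s := Finset.univ) (fun s _ => (hYsub s).neg) htx
  have hexp : -(t * x) ^ 2 / (2 * ((∑ _s : Fin t, d : ℝ≥0) : ℝ)) = -(t * x ^ 2 / (2 * d)) := by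
    simp only [Finset.sum_const, Finset.card_univ, Fintype.card_fin, nsmul_eq_mul, NNReal.coe_mul,
      NNReal.coe_natCast]
    rw [neg_div, show (t * x : ℝ) ^ 2 = t * (t * x ^ 2) by ring,
      show (2 * (t * d) : ℝ) = t * (2 * d) by ring, mul_div_mul_left _ _ ht'.ne']
  rw [hexp] at h1 h2
  have hsubset : {ω | x ≤ |1 / t * ∑ s : Fin t, f (X s ω) - ∫ y, f y ∂μ|} ⊆
      {ω | t * x ≤ ∑ s, Y s ω} ∪ {ω | t * x ≤ ∑ s, -Y s ω} := by
    intro ω hω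
    have hsum : ∑ s, Y s ω = t * (1 / t * ∑ s : Fin t, f (X s ω) - ∫ y, f y ∂μ) := by
      simp only [hY, Finset.sum_sub_distrib, Finset.sum_const, Finset.card_univ, Fintype.card_fin,
        nsmul_eq_mul]
      field_simp
    simp only [mem_union, mem_ofPred_eq, Finset.sum_neg_distrib, hsum] at hω ⊢
    rcases le_abs.1 hω with h | h
    · exact Or.inl (mul_le_mul_of_nonneg_left h ht'.le)
    · right
      rw [← mul_neg]
      exact mul_le_mul_of_nonneg_left h ht'.le
  refine (measureReal_mono hsubset).trans ((measureReal_union_le _ _).trans ?_)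
  linarith

omit [IsProbabilityMeasure μ] in
lemma hasLaw_sample (hX : ∀ s, HasLaw (X s) μ P) (hind : iIndepFun X P) (t : ℕ) :
    HasLaw (fun ω (s : Fin t) => X s ω) (Measure.pi fun _ => μ) P := by
  have hm : ∀ s : Fin t, AEMeasurable (X s) P := fun s => (hX s).aemeasurable
  refine ⟨aemeasurable_pi_lambda _ hm, ?_⟩
  rw [(iIndepFun_iff_map_fun_eq_pi_map hm).1 (hind.precomp Fin.val_injective)]
  simp only [(hX _).map_eq]

/-- The Dvoretzky–Kiefer–Wolfowitz inequality, with non-optimal constants. -/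
lemma measureReal_oneSampleDev_sample_ge_le (hX : ∀ s, HasLaw (X s) μ P) (hind : iIndepFun X P)
    (t : ℕ) {x : ℝ} (hx : 0 ≤ x) :
    P.real {ω | t * x ≤ oneSampleDev μ fun s : Fin t => X s ω}
      ≤ 4 * Real.exp (-(t * x ^ 2 / 8)) := by
  rw [(hasLaw_sample hX hind t).measureReal_eq (p := fun z => t * x ≤ oneSampleDev μ z)
    (measurableSet_le measurable_const (measurable_oneSampleDev μ))]
  exact measureReal_oneSampleDev_ge_le μ hx

/-- A pointwise inclusion of events, so measurability of the norm is not needed. -/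
lemma max_le_of_cvarNorm_empirical (hμ : Integrable (fun x => x) μ) {t : ℕ} (ht : 1 ≤ t)
    (z : Fin t → ℝ) {x : ℝ} (hx : x ≤ cvarNorm (empirical z - μ.toSignedMeasure)) :
    t * x ≤ oneSampleDev μ z ∨ x ≤ |1 / t * ∑ s, min (z s) 0 - ∫ y, min y 0 ∂μ| ∨
      x ≤ |1 / t * ∑ s, max (z s) 0 - ∫ y, max y 0 ∂μ| := by
  have ht' : (0 : ℝ) < t := by exact_mod_cast ht
  obtain ⟨ν, _, hν, heq, hcdf, hl, hu⟩ := exists_empirical_eq ht z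
  rw [heq, cvarNorm_toSignedMeasure_sub hν hμ, le_max_iff, le_max_iff, hl, hu, lowerMean_eq,
    upperMean_eq] at hx
  refine hx.imp_left fun h => ?_
  have := iSup_abs_sub_le_of_rat (μ := ν) (ν := μ) (C := oneSampleDev μ z / t) fun q => by
    rw [le_div_iff₀ ht', ← abs_of_pos ht', ← abs_mul, hcdf]
    refine le_trans (le_of_eq ?_) (le_oneSampleDev μ z q)
    congr 1
    simp only [Finset.sum_sub_distrib, Finset.sum_const, Finset.card_univ, Fintype.card_fin,
      nsmul_eq_mul]
    field_simp
  rw [mul_comm]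
  exact (le_div_iff₀ ht').1 (h.trans this)

lemma measureReal_cvarNorm_empirical_ge_le (hX : ∀ s, HasLaw (X s) μ P) (hind : iIndepFun X P)
    {c d : ℝ≥0} (hμ : HasSubgaussianMGF (fun x => x - ∫ y, y ∂μ) c μ) (hcd : 2 * c ≤ d)
    (hd : 4 ≤ d) {t : ℕ} (ht : 1 ≤ t) {x : ℝ} (hx : 0 < x) :
    P.real {ω | x ≤ cvarNorm (empirical (fun s : Fin t => X s ω) - μ.toSignedMeasure)}
      ≤ 2 * Real.exp (-(1 / (6 * d)) * t * x ^ 2) := by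
  have hint : Integrable (fun x => x) μ := IsSubGaussian.integrable ⟨c, hμ⟩
  have hd' : (4 : ℝ) ≤ d := by exact_mod_cast hd
  have h1 := measureReal_oneSampleDev_sample_ge_le hX hind t hx.le
  have h2 := measureReal_abs_mean_sub_ge_le hX hind (f := fun y => min y 0) (by fun_prop)
    (hasSubgaussianMGF_of_lipschitz hμ (by fun_prop)
      (fun a b => by simpa using abs_min_sub_min_le_max a 0 b 0) (integrable_min_zero hint) hcd)
    ht hx
  have h3 := measureReal_abs_mean_sub_ge_le hX hind (f := fun y => max y 0) (by fun_prop)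
    (hasSubgaussianMGF_of_lipschitz hμ (by fun_prop)
      (fun a b => by simpa using abs_max_sub_max_le_max a 0 b 0) (integrable_max_zero hint) hcd)
    ht hx
  set p := P.real {ω | x ≤ cvarNorm (empirical (fun s : Fin t => X s ω) - μ.toSignedMeasure)}
  -- 8 = 4 + 2 + 2; `4 ≤ d` makes the exponent `1/8` at least `1/(2d)`.
  have hp : p ≤ 8 * Real.exp (-(t * x ^ 2 / (2 * d))) := by
    have h4 : Real.exp (-(t * x ^ 2 / 8)) ≤ Real.exp (-(t * x ^ 2 / (2 * d))) := by
      refine Real.exp_le_exp.2 (neg_le_neg (div_le_div_of_nonneg_left (by positivity) ?_ ?_)) <;>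
        linarith
    refine (measureReal_mono fun ω hω => ?_).trans
      ((measureReal_union_le _ _).trans ((add_le_add h1 ((measureReal_union_le _ _).trans
        (add_le_add h2 h3))).trans ?_))
    · exact max_le_of_cvarNorm_empirical hint ht _ hω
    · linarith
  have hp1 : p ≤ 1 := measureReal_le_one
  set r := Real.exp (-(1 / (6 * d)) * t * x ^ 2) with hr
  have hr0 : 0 < r := Real.exp_pos _
  have hr3 : Real.exp (-(t * x ^ 2 / (2 * d))) = r ^ 3 := by
    rw [hr, ← Real.exp_nat_mul]
    congr 1
    push_cast
    field_simp
    ring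
  rw [hr3] at hp
  -- `min 1 (8 r³) ≤ 2 r`: use `p ≤ 1` when `r ≥ 1/2`, and `4 r² ≤ 1` otherwise.
  rcases le_total (1 / 2) r with h | h
  · linarith
  · have : r ^ 2 ≤ 1 / 4 := by nlinarith
    nlinarith

end Concentration

/-! ### Strong stability -/

lemma exists_isGreatest_cvarNorm {K : ℕ} (hK : 0 < K) {F : Fin K → Measure ℝ}
    [∀ i, IsProbabilityMeasure (F i)] (hF : ∀ i, Integrable (fun x => x) (F i)) :
    ∃ c, IsGreatest (cvarNorm '' mixtures F) c := by
  set g : (Fin K → ℝ) → ℝ := fun p =>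
    max 1 (max |∑ i, p i * lowerMean (F i)| |∑ i, p i * upperMean (F i)|) with hg
  have hgc : Continuous g := by fun_prop
  have hgN : ∀ p ∈ stdSimplex ℝ (Fin K),
      cvarNorm (∑ i, p i • (F i).toSignedMeasure) = g p := by
    intro p hp
    obtain ⟨μ, _, _, heq, hl, hu⟩ := exists_of_mem_mixtures hF hp
    rw [heq, cvarNorm_toSignedMeasure, hl, hu]
  have hne : (stdSimplex ℝ (Fin K)).Nonempty := ⟨_, single_mem_stdSimplex ℝ (⟨0, hK⟩ : Fin K)⟩
  obtain ⟨p, hp, hmax⟩ :=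
    (isCompact_stdSimplex ℝ (Fin K)).exists_isMaxOn hne hgc.continuousOn
  refine ⟨g p, ⟨_, ⟨p, hp, rfl⟩, hgN p hp⟩, ?_⟩
  rintro _ ⟨_, ⟨q, hq, rfl⟩, rfl⟩
  rw [hgN q hq]
  exact hmax hq

lemma exists_of_mem_union {K : ℕ} {F : Fin K → Measure ℝ} [∀ i, IsProbabilityMeasure (F i)]
    (hF : ∀ i, Integrable (fun x => x) (F i)) {ν : SignedMeasure ℝ}
    (hν : ν ∈ mixtures F ∪ empiricals) :
    ∃ (μ : Measure ℝ) (_ : IsProbabilityMeasure μ), Integrable (fun x => x) μ ∧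
      ν = μ.toSignedMeasure := by
  rcases hν with ⟨p, hp, rfl⟩ | ⟨t, ht, x, rfl⟩
  · obtain ⟨μ, h, hi, heq, -⟩ := exists_of_mem_mixtures hF hp
    exact ⟨μ, h, hi, heq⟩
  · obtain ⟨μ, h, hi, heq, -⟩ := exists_empirical_eq ht x
    exact ⟨μ, h, hi, heq⟩

end CVaRBandit

theorem mainTheorem8 {K : ℕ} (hK : 0 < K) (F : Fin K → Measure ℝ)
    [∀ i, IsProbabilityMeasure (F i)] (hF : ∀ i, CVaRBandit.IsSubGaussian (F i))
    (α : ℝ) (hα : α ∈ Set.Ioo (0 : ℝ) 1) :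
    ∃ c : ℝ, IsGreatest (CVaRBandit.cvarNorm '' CVaRBandit.mixtures F) c ∧
      CVaRBandit.IsStronglyStable.{u} CVaRBandit.cvarNorm (CVaRBandit.CVaR α) F
        (1 / α * (1 + max 1 (3 * c) / min α (1 - α))) 2 := by
  have hint := fun i => (hF i).integrable
  obtain ⟨c, hc⟩ := CVaRBandit.exists_isGreatest_cvarNorm hK hint
  refine ⟨c, hc, ?_, one_le_two, fun μ hμ ν hν => ?_, ?_⟩
  · have h1 : 0 < α := hα.1
    have h2 : 0 < min α (1 - α) := lt_min hα.1 (sub_pos.2 hα.2)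
    have h3 : 0 < max 1 (3 * c) := lt_max_of_lt_left one_pos
    positivity
  · have hμc := hc.2 (Set.mem_image_of_mem _ hμ)
    obtain ⟨μ, _, hμi, rfl⟩ := CVaRBandit.exists_of_mem_union hint (Or.inl hμ)
    obtain ⟨ν, _, hνi, rfl⟩ := CVaRBandit.exists_of_mem_union hint hν
    exact CVaRBandit.abs_CVaR_sub_le hμi hνi hα hμc
  · choose σ hσ using hF
    -- One `d` for all arms: it dominates 4 and every doubled variance proxy.
    refine ⟨1 / (6 * (4 + ∑ i, 2 * σ i : ℝ≥0)), by positivity, ?_⟩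
    intro i Ω _ P _ X hX hind t ht x hx
    refine CVaRBandit.measureReal_cvarNorm_empirical_ge_le hX hind (hσ i) ?_ le_self_add ht hx
    exact (Finset.single_le_sum (f := fun i => 2 * σ i) (fun _ _ => zero_le)
      (Finset.mem_univ i)).trans le_add_self
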